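/- Let $(X,d)$ be a compact metric space, let $f_n:X\to X$ ($n\ge 0$) be continuous, and put $f_n^0=\mathrm{id}$, $f_n^k=f_{n+k-1}\circ\cdots\circ f_n$ for $k\ge1$, and $f_n^{-k}(S)=(f_n^k)^{-1}(S)$ for $S\subset X$. Let $N\ge 2$ and let $A=(a_{ij})_{N\times N}$ be a transition matrix, i.e. all $a_{ij}\in\{0,1\}$ and no row or column of $A$ is zero. Let $$\Sigma_N^+(A)=\{(s_0,s_1,\dots):1\le s_j\le N,\ a_{s_js_{j+1}}=1\text{ for all }j\ge0\},$$ with the metric $\hat\rho(\alpha,\beta)=\sum_{i\ge0}\hat d(a_i,b_i)/2^i$ for $\alpha=(a_i)$, $\beta=(b_i)$, where $\hat d(a,b)=0$ if $a=b$ and $\hat d(a,b)=1$ otherwise, and let $\sigma_A(s_0,s_1,\dots)=(s_1,s_2,\dots)$. Let $\rho(A)=\lim_{n\to\infty}\|A^n\|^{1/n}$, where $\|\cdot\|$ is the sum of the entries. Let $V_{i,n}$ ($1\le i\le N$, $n\ge0$) be nonempty closed subsets of $X$, and for $\alpha=(a_0,a_1,\dots)\in\Sigma_N^+(A)$ and $m,n\ge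 0$ put $V_\alpha^{m,n}=\bigcap_{k=0}^m f_n^{-k}(V_{a_k,n+k})$. (These are the standing assumptions $H_3$.) Assume moreover: ($H_1$) $V_\alpha^{m,n}\ne\emptyset$ for all $m,n\ge0$ and all $\alpha\in\Sigma_N^+(A)$; ($H_2$) for every $\alpha\in\Sigma_N^+(A)$, the diameter of $V_\alpha^{m,n}$ converges to $0$ as $m\to\infty$, uniformly in $n\ge0$. Let $\mathcal K(X)$ be the space of nonempty compact subsets of $X$ with the Hausdorff metric $\mathcal H_d$, let $\bar f_n:\mathcal K(X)\to\mathcal K(X)$ be $\bar f_n(K)=f_n(K)$, and let $\langle V\rangle=\{K\in\mathcal K(X):K\subset V\}$. Then there are nonempty compact sets $\mathcal C_n\subset\bigcup_{i=1}^N\langle V_{i,n}\rangle$ ($n\ge0$) with $\bar f_n(\mathcal C_n)=\mathcal C_{n+1}$ for all $n\geq 0$, such that $(\Sigma_N^+(A),\sigma_A)$ is topologically equi-semiconjugate to the invariant subsystem of $(\bar f_n)_{n\ge0}$ on $(\mathcal C_n)_{n\ge0}$: there are surjective maps $h_n:\Sigma_N^+(A)\to\mathcal C_n$ with $h_{n+1}\circ\sigma_A=\bar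 f_n\circ h_n$ for all $n\ge0$, which are equi-continuous, i.e. for every $\varepsilon>0$ there is $\delta>0$ such that for all $n\ge0$ and all $\alpha,\beta$, $\hat\rho(\alpha,\beta)<\delta$ implies $\mathcal H_d(h_n(\alpha),h_n(\beta))<\varepsilon$. Consequently, $h(\bar f_{0,\infty},\mathcal C_0)\le\log\rho(A)$. Here, for a compact metric space $Z$, a sequence $g_{0,\infty}=(g_n)_{n\ge0}$ of maps $g_n:Z\to Z$ (with $g_0^{-j}$ denoting the preimage under $g_{j-1}\circ\cdots\circ g_0$) and a nonempty $Y\subset Z$, $$h(g_{0,\infty},Y)=\sup_{\mathcal A}\limsup_{n\to\infty}\frac1n\log\mathcal N(\mathcal A_0^n|_Y),$$ where $\mathcal A$ runs over the open covers of $Z$, $\mathcal A_0^n=\{\bigcap_{j=0}^{n-1}g_0^{-j}(A_j):A_j\in\mathcal A\}$, $\mathcal A_0^n|_Y=\{B\cap Y:B\in\mathcal A_0^n\}$, and $\mathcal N$ is the minimal cardinality of a subcover (of $Y$). -/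

import Mathlib

open Filter Topology TopologicalSpace

namespace NDS

/-! ### Non-autonomous discrete systems `x_{n+1} = f_n (x_n)` -/

/-- The composition `f_i^k = f_{i+k-1} ∘ ⋯ ∘ f_i`, with `f_i^0 = id`. -/
def iter {X : Type*} (f : ℕ → X → X) (i : ℕ) : ℕ → X → X
  | 0 => id
  | k + 1 => f (i + k) ∘ iter f i k

/-- The sequence of sets `Λ_n` is invariant: `f_n (Λ_n) ⊆ Λ_{n+1}` for all `n`. -/
def IsInvariant {X : Type*} (f : ℕ → X → X) (Λ : ℕ → Set X) : Prop :=
  ∀ n, Set.MapsTo (f n) (Λ n) (Λ (n + 1))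

/-- Equi-continuity of a sequence of maps `h_n : Λ_n → E_n` in `{Λ_n}`: one `δ` serves all `n`. -/
def IsEquicontinuousIn {X Y : Type*} [MetricSpace X] [MetricSpace Y]
    {Λ : ℕ → Set X} {E : ℕ → Set Y} (h : ∀ n, Λ n → E n) : Prop :=
  ∀ ε > 0, ∃ δ > 0, ∀ n, ∀ x y : Λ n, dist x y < δ → dist (h n x) (h n y) < ε

/-- The invariant subsystem of `(X, f)` on `{Λ_n}` is topologically equi-semiconjugate to the
invariant subsystem of `(Y, g)` on `{E_n}`: there are equi-continuous surjections
`h_n : Λ_n → E_n` with `h_{n+1} ∘ f_n = g_n ∘ h_n`. -/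
def EquiSemiconjugate {X Y : Type*} [MetricSpace X] [MetricSpace Y]
    (f : ℕ → X → X) (Λ : ℕ → Set X) (g : ℕ → Y → Y) (E : ℕ → Set Y) : Prop :=
  ∃ hΛ : IsInvariant f Λ, IsInvariant g E ∧
    ∃ h : ∀ n, Λ n → E n, IsEquicontinuousIn h ∧ (∀ n, Function.Surjective (h n)) ∧
      ∀ n, ∀ x : Λ n, (h (n + 1) ⟨f n x, hΛ n x.2⟩ : Y) = g n (h n x)

/-! ### Topological entropy through open covers -/

/-- `𝒜` is an open cover of `X`. -/
def IsOpenCover {X : Type*} [TopologicalSpace X] (𝒜 : Set (Set X)) : Prop :=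
  (∀ U ∈ 𝒜, IsOpen U) ∧ ⋃₀ 𝒜 = Set.univ

/-- `𝒜_0^n = {⋂_{j<n} f_0^{-j}(A_j) : A_j ∈ 𝒜}`. -/
def refinedCover {X : Type*} (f : ℕ → X → X) (𝒜 : Set (Set X)) (n : ℕ) : Set (Set X) :=
  {B | ∃ U : Fin n → Set X, (∀ j, U j ∈ 𝒜) ∧ B = ⋂ j : Fin n, iter f 0 j ⁻¹' U j}

/-- The cover `𝒜|_Y = {U ∩ Y : U ∈ 𝒜}` of `Y`. -/
def restrictCover {X : Type*} (𝒜 : Set (Set X)) (Y : Set X) : Set (Set X) :=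
  (fun U => U ∩ Y) '' 𝒜

/-- The minimal cardinality of a subfamily of `𝒞` that covers `Y` (`⊤` if no finite one does). -/
noncomputable def coverNumber {X : Type*} (𝒞 : Set (Set X)) (Y : Set X) : ℕ∞ :=
  ⨅ (F : Set (Set X)) (_ : F ⊆ 𝒞) (_ : Y ⊆ ⋃₀ F), F.encard

/-- The topological entropy `h(f_{0,∞}, Y) = sup_𝒜 limsup_n (1/n) log 𝒩(𝒜_0^n|_Y)`,
as an extended real number. -/
noncomputable def topEntropy {X : Type*} [TopologicalSpace X] (f : ℕ → X → X) (Y : Set X) :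
    EReal :=
  ⨆ (𝒜 : Set (Set X)) (_ : IsOpenCover 𝒜),
    limsup (fun n : ℕ =>
      ENNReal.log (coverNumber (restrictCover (refinedCover f 𝒜 n) Y) Y : ENNReal) /
        (n : EReal)) atTop

/-! ### Transition matrices and subshifts of finite type -/

/-- An `N × N` matrix (`N ≥ 2`) with entries `0` or `1` and no zero row or column.
The symbols are the elements of `Fin N`. -/
structure IsTransitionMatrix {N : ℕ} (A : Matrix (Fin N) (Fin N) ℕ) : Prop where
  two_le : 2 ≤ N
  zero_or_one : ∀ i j, A i j = 0 ∨ A i j = 1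
  row : ∀ i, 1 ≤ ∑ j, A i j
  col : ∀ j, 1 ≤ ∑ i, A i j

/-- The norm `‖A‖ = ∑_{i,j} a_{ij}` (for matrices with nonnegative entries). -/
def entrySum {N : ℕ} (A : Matrix (Fin N) (Fin N) ℕ) : ℕ := ∑ i, ∑ j, A i j

/-- `ρ(A) = lim_n ‖A^n‖^{1/n}`; the limit exists, see `tendsto_rho`. -/
noncomputable def rho {N : ℕ} (A : Matrix (Fin N) (Fin N) ℕ) : ℝ :=
  limUnder atTop (fun n : ℕ => (entrySum (A ^ n) : ℝ) ^ (1 / (n : ℝ)))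

theorem entrySum_mul_le {N : ℕ} (A B : Matrix (Fin N) (Fin N) ℕ) :
    entrySum (A * B) ≤ entrySum A * entrySum B := by
  unfold entrySum
  rw [Finset.sum_mul]
  refine Finset.sum_le_sum fun i _ => ?_
  simp only [Matrix.mul_apply]
  rw [Finset.sum_comm, Finset.sum_mul]
  refine Finset.sum_le_sum fun k _ => ?_
  rw [← Finset.mul_sum]
  exact Nat.mul_le_mul_left _
    (Finset.single_le_sum (f := fun k => ∑ j, B k j) (fun _ _ => Nat.zero_le _)
      (Finset.mem_univ k))

theorem one_le_entrySum_pow {N : ℕ} {A : Matrix (Fin N) (Fin N) ℕ} (hA : IsTransitionMatrix A)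
    (n : ℕ) : 1 ≤ entrySum (A ^ n) := by
  have key : ∀ n : ℕ, ∀ i, 1 ≤ ∑ j, (A ^ n) i j := by
    intro n
    induction n with
    | zero => intro i; simp [Matrix.one_apply]
    | succ n ih =>
      intro i
      rw [pow_succ']
      simp only [Matrix.mul_apply]
      rw [Finset.sum_comm]
      refine (hA.row i).trans (Finset.sum_le_sum fun k _ => ?_)
      rw [← Finset.mul_sum]
      exact Nat.le_mul_of_pos_right _ (ih k)
  have h0 : 0 < N := by have := hA.two_le; omega
  exact (key n ⟨0, h0⟩).trans
    (Finset.single_le_sum (f := fun i => ∑ j, (A ^ n) i j) (fun _ _ => Nat.zero_le _)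
      (Finset.mem_univ _))

/-- The limit that defines `ρ(A)` exists for every transition matrix. -/
theorem tendsto_rho {N : ℕ} {A : Matrix (Fin N) (Fin N) ℕ} (hA : IsTransitionMatrix A) :
    Tendsto (fun n : ℕ => (entrySum (A ^ n) : ℝ) ^ (1 / (n : ℝ))) atTop (𝓝 (rho A)) := by
  have hpos : ∀ n, (1 : ℝ) ≤ entrySum (A ^ n) := fun n => by
    exact_mod_cast one_le_entrySum_pow hA n
  have hsub : Subadditive (fun n : ℕ => Real.log (entrySum (A ^ n))) := by
    intro m n
    have hm := hpos m
    have hn := hpos n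
    rw [← Real.log_mul (by positivity) (by positivity)]
    refine Real.log_le_log (by linarith [hpos (m + n)]) ?_
    rw [pow_add]
    exact_mod_cast entrySum_mul_le (A ^ m) (A ^ n)
  have hbdd : BddBelow (Set.range fun n : ℕ => Real.log (entrySum (A ^ n)) / n) := by
    refine ⟨0, ?_⟩
    rintro _ ⟨n, rfl⟩
    exact div_nonneg (Real.log_nonneg (hpos n)) (Nat.cast_nonneg n)
  have hlim := (Real.continuous_exp.tendsto _).comp (hsub.tendsto_lim hbdd)
  refine tendsto_nhds_limUnder ⟨_, hlim.congr fun n => ?_⟩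
  rw [Real.rpow_def_of_pos (by linarith [hpos n])]
  simp [div_eq_mul_inv]

/-- The one-sided sequence space `Σ_N^+(A)`: sequences of symbols all of whose
transitions are allowed by `A`. -/
@[ext]
structure SFT {N : ℕ} (A : Matrix (Fin N) (Fin N) ℕ) where
  seq : ℕ → Fin N
  adm : ∀ j, A (seq j) (seq (j + 1)) = 1

/-- The discrete distance on symbols. -/
def symDist {N : ℕ} (a b : Fin N) : ℝ := if a = b then 0 else 1

theorem summable_symDist {N : ℕ} (a b : ℕ → Fin N) :
    Summable fun i => symDist (a i) (b i) / 2 ^ i := by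
  refine Summable.of_nonneg_of_le (fun i => ?_) (fun i => ?_) summable_geometric_two
  · unfold symDist; split_ifs <;> positivity
  · unfold symDist; split_ifs <;> simp

/-- The metric `ρ̂(α, β) = ∑_i d̂(a_i, b_i) / 2^i` on `Σ_N^+(A)`. -/
noncomputable instance {N : ℕ} (A : Matrix (Fin N) (Fin N) ℕ) : MetricSpace (SFT A) where
  dist α β := ∑' i, symDist (α.seq i) (β.seq i) / 2 ^ i
  dist_self α := by simp [symDist]
  dist_comm α β := by simp [symDist, eq_comm]
  dist_triangle α β γ := by
    rw [← (summable_symDist _ _).tsum_add (summable_symDist _ _)]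
    refine (summable_symDist _ _).tsum_le_tsum (fun i => ?_)
      ((summable_symDist _ _).add (summable_symDist _ _))
    rw [← add_div]
    gcongr
    unfold symDist
    split_ifs <;> simp_all
  eq_of_dist_eq_zero {α β} h := by
    change (∑' i, symDist (α.seq i) (β.seq i) / 2 ^ i) = 0 at h
    have h0 : ∀ i, 0 ≤ symDist (α.seq i) (β.seq i) / 2 ^ i := fun i => by
      unfold symDist; split_ifs <;> positivity
    have h1 := ((summable_symDist α.seq β.seq).hasSum_iff.2 h)
    rw [hasSum_zero_iff_of_nonneg h0] at h1
    refine SFT.ext (funext fun i => ?_)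
    by_contra hne
    have := congrFun h1 i
    simp [symDist, hne] at this

/-- The subshift `σ_A (s_0, s_1, s_2, …) = (s_1, s_2, …)`. -/
def shift {N : ℕ} (A : Matrix (Fin N) (Fin N) ℕ) (s : SFT A) : SFT A where
  seq j := s.seq (j + 1)
  adm j := s.adm (j + 1)

/-! ### Itinerary sets -/

/-- `V_α^{m,n} = ⋂_{k=0}^m f_n^{-k}(V_{a_k, n+k})`. -/
def itinSet {X : Type*} {N : ℕ} {A : Matrix (Fin N) (Fin N) ℕ} (f : ℕ → X → X)
    (V : Fin N → ℕ → Set X) (α : SFT A) (m n : ℕ) : Set X :=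
  ⋂ (k : ℕ) (_ : k ≤ m), iter f n k ⁻¹' V (α.seq k) (n + k)

/-- Every finite itinerary along an admissible sequence is realized. -/
def H1 {X : Type*} {N : ℕ} (A : Matrix (Fin N) (Fin N) ℕ) (f : ℕ → X → X)
    (V : Fin N → ℕ → Set X) : Prop :=
  ∀ (m n : ℕ) (α : SFT A), (itinSet f V α m n).Nonempty

/-- For each `α`, the diameter of `V_α^{m,n}` tends to `0` as `m → ∞`, uniformly in `n`. -/
def H2 {X : Type*} [MetricSpace X] {N : ℕ} (A : Matrix (Fin N) (Fin N) ℕ) (f : ℕ → X → X)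
    (V : Fin N → ℕ → Set X) : Prop :=
  ∀ α : SFT A, ∀ ε > 0, ∃ M, ∀ m ≥ M, ∀ n, Metric.diam (itinSet f V α m n) < ε

/-! ### The induced set-valued system

`NonemptyCompacts X` is the space `𝒦(X)` of nonempty compact subsets with the Hausdorff metric. -/

/-- The induced map `f̄_n (K) = f_n (K)` on `𝒦(X)`. -/
def induced {X : Type*} [TopologicalSpace X] (f : ℕ → X → X) (hf : ∀ n, Continuous (f n)) (n : ℕ) :
    NonemptyCompacts X → NonemptyCompacts X :=
  NonemptyCompacts.map (f n) (hf n)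

/-- `⟨K⟩ = {B ∈ 𝒦(X) : B ⊆ K}`. -/
def hyper {X : Type*} [TopologicalSpace X] (K : Set X) : Set (NonemptyCompacts X) :=
  {B | (B : Set X) ⊆ K}

end NDS

namespace NDS

open Set

/-! ### The subshift as a compact metric space -/

section Subshift

variable {N : ℕ} {A : Matrix (Fin N) (Fin N) ℕ}

/-! The map `h_n` sends `α` to the set `⋂_m V_α^{m,n}` of points that follow `α` from time `n` on.
It is nonempty by H1 and compactness and has at most one point by H2. Since `f_n` carries the points
following `α` to points following `σ_A α`, the one-point sets satisfy `h_{n+1} ∘ σ_A = f̄_n ∘ h_n`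
(`limitCompact_shift`). Take `C_n` to be the range of `h_n`. Surjectivity of the shift gives
`f̄_n(C_n) = C_{n+1}`.

Equi-continuity (`limitCompact_equicontinuous`): H2 gives a depth that may depend on `α` but not on
`n`. Compactness of the subshift removes the dependence on `α`.

Entropy (`topEntropy_le_of_equicontinuous_factor`): by equi-continuity, if two sequences share a
prefix of length `n + M + 1`, the first `n` points of the orbits of their images are close enough to
lie in a common member of the refined cover. So the cover number is at most the number of such
words, which is at most `‖A^(n+M)‖ ≤ ‖A^n‖ ‖A^M‖`. The factor `‖A^M‖` disappears in the growth rate.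
-/

theorem symDist_nonneg (a b : Fin N) : 0 ≤ symDist a b := by
  unfold symDist; split_ifs <;> simp

theorem symDist_le_one (a b : Fin N) : symDist a b ≤ 1 := by
  unfold symDist; split_ifs <;> simp

theorem SFT.dist_def (α β : SFT A) :
    dist α β = ∑' i, symDist (α.seq i) (β.seq i) / 2 ^ i := rfl

/-- A disagreement at one index `k ≤ m` already contributes `2^{-k} ≥ 2^{-m}` to the distance. -/
theorem SFT.seq_eq_of_dist_lt {α β : SFT A} {m : ℕ} (h : dist α β < (1 / 2) ^ m) {k : ℕ}
    (hk : k ≤ m) : α.seq k = β.seq k := by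
  by_contra hne
  have hle : symDist (α.seq k) (β.seq k) / 2 ^ k ≤ dist α β :=
    (summable_symDist α.seq β.seq).le_tsum k
      fun i _ => div_nonneg (symDist_nonneg _ _) (by positivity)
  have hone : symDist (α.seq k) (β.seq k) / 2 ^ k = (1 / 2) ^ k := by
    simp [symDist, hne]
  have hpow : ((1 : ℝ) / 2) ^ m ≤ (1 / 2) ^ k :=
    pow_le_pow_of_le_one (by norm_num) (by norm_num) hk
  linarith

theorem SFT.dist_le_of_seq_eq {α β : SFT A} {m : ℕ} (h : ∀ k ≤ m, α.seq k = β.seq k) :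
    dist α β ≤ (1 / 2) ^ m := by
  have hs := summable_symDist α.seq β.seq
  have hzero : ∑ i ∈ Finset.range (m + 1), symDist (α.seq i) (β.seq i) / 2 ^ i = 0 := by
    refine Finset.sum_eq_zero fun i hi => ?_
    rw [h i (by simpa [Nat.lt_succ_iff] using hi)]
    simp [symDist]
  have htail : ∑' i, symDist (α.seq (i + (m + 1))) (β.seq (i + (m + 1))) / 2 ^ (i + (m + 1)) ≤
      ∑' i : ℕ, (1 / 2 : ℝ) ^ (m + 1) * (1 / 2) ^ i := by
    refine ((summable_nat_add_iff (m + 1)).2 hs).tsum_le_tsum (fun i => ?_)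
      (summable_geometric_two.mul_left _)
    rw [← pow_add, add_comm (m + 1) i, one_div_pow]
    exact div_le_div_of_nonneg_right (symDist_le_one _ _) (by positivity)
  rw [SFT.dist_def, ← hs.sum_add_tsum_nat_add (m + 1), hzero, zero_add]
  refine htail.trans (le_of_eq ?_)
  rw [tsum_mul_left, tsum_geometric_two, pow_succ]
  ring

/-- The sequences that agree with `α` up to index `m`. -/
def cylinder (α : SFT A) (m : ℕ) : Set (SFT A) := {β | ∀ k ≤ m, α.seq k = β.seq k}

theorem mem_cylinder_self (α : SFT A) (m : ℕ) : α ∈ cylinder α m := fun _ _ => rfl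

theorem isOpen_cylinder (α : SFT A) (m : ℕ) : IsOpen (cylinder α m) := by
  refine Metric.isOpen_iff.2 fun β hβ => ⟨(1 / 2) ^ m, by positivity, fun γ hγ k hk => ?_⟩
  rw [hβ k hk]
  exact SFT.seq_eq_of_dist_lt (by rwa [dist_comm]) hk

instance SFT.compactSpace : CompactSpace (SFT A) := by
  -- The subshift is a continuous image of a closed subset of the compact product `(Fin N)^ℕ`.
  let S : Set (ℕ → Fin N) := {s | ∀ j, A (s j) (s (j + 1)) = 1}
  have hS : IsClosed S := by
    simp only [S, ofPred_forall]
    refine isClosed_iInter fun j => ?_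
    have hcont : Continuous fun s : ℕ → Fin N => (s j, s (j + 1)) := by fun_prop
    exact (isClosed_discrete {p : Fin N × Fin N | A p.1 p.2 = 1}).preimage hcont
  have : CompactSpace S := isCompact_iff_compactSpace.1 hS.isCompact
  let g : S → SFT A := fun s => ⟨s.1, s.2⟩
  have hg : Continuous g := by
    refine continuous_iff_continuousAt.2 fun s => Metric.tendsto_nhds.2 fun ε hε => ?_
    obtain ⟨m, hm⟩ := exists_pow_lt_of_lt_one hε (by norm_num : (1 / 2 : ℝ) < 1)
    have hev : ∀ᶠ t : S in 𝓝 s, ∀ k ∈ Finset.range (m + 1), t.1 k = s.1 k := by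
      refine (Finset.eventually_all _).2 fun k _ => ?_
      have hcont : Continuous fun t : S => t.1 k :=
        (continuous_apply k).comp continuous_subtype_val
      exact hcont.continuousAt.eventually (isOpen_discrete {s.1 k} |>.mem_nhds rfl)
    filter_upwards [hev] with t ht
    exact (SFT.dist_le_of_seq_eq fun k hk => ht k (by simpa [Nat.lt_succ_iff] using hk)).trans_lt hm
  have hsurj : Function.Surjective g := fun α => ⟨⟨α.seq, α.adm⟩, rfl⟩
  exact hsurj.compactSpace hg

/-! ### Transition matrices: surjectivity of the shift and counting of words -/

theorem IsTransitionMatrix.exists_next (hA : IsTransitionMatrix A) (i : Fin N) :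
    ∃ j, A i j = 1 := by
  by_contra! h
  have hrow := hA.row i
  rw [Finset.sum_eq_zero fun j _ => (hA.zero_or_one i j).resolve_right (h j)] at hrow
  omega

theorem IsTransitionMatrix.exists_prev (hA : IsTransitionMatrix A) (j : Fin N) :
    ∃ i, A i j = 1 := by
  by_contra! h
  have hcol := hA.col j
  rw [Finset.sum_eq_zero fun i _ => (hA.zero_or_one i j).resolve_right (h i)] at hcol
  omega

theorem IsTransitionMatrix.nonempty_SFT (hA : IsTransitionMatrix A) : Nonempty (SFT A) := by
  choose next hnext using hA.exists_next
  have h0 : 0 < N := by have := hA.two_le; omega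
  exact ⟨⟨fun k => next^[k] ⟨0, h0⟩, fun k => by
    rw [Function.iterate_succ_apply']; exact hnext _⟩⟩

theorem IsTransitionMatrix.shift_surjective (hA : IsTransitionMatrix A) :
    Function.Surjective (shift A) := by
  intro α
  obtain ⟨i, hi⟩ := hA.exists_prev (α.seq 0)
  refine ⟨⟨fun k => Nat.casesOn k i α.seq, fun k => ?_⟩, rfl⟩
  cases k with
  | zero => exact hi
  | succ k => exact α.adm k

theorem shift_iterate_seq (α : SFT A) (j k : ℕ) : ((shift A)^[j] α).seq k = α.seq (k + j) := by
  induction j generalizing k with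
  | zero => rfl
  | succ j ih =>
    rw [Function.iterate_succ_apply']
    exact (ih (k + 1)).trans (congrArg α.seq (by omega))

open Classical in
/-- The words of length `L + 1` that begin some sequence of the subshift starting at `i`. -/
noncomputable def wordsFrom (A : Matrix (Fin N) (Fin N) ℕ) (L : ℕ) (i : Fin N) :
    Finset (Fin (L + 1) → Fin N) :=
  Finset.univ.filter fun w => ∃ α : SFT A, α.seq 0 = i ∧ ∀ k : Fin (L + 1), w k = α.seq k

/-- Induction on the first letter, mirroring `A^(L+1) = A * A^L`: a word from `i` is `i` followed by
a word from some `k` with `A i k = 1`. The exponent is `L` because `L + 1` letters make `L`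
transitions. -/
theorem card_wordsFrom_le (L : ℕ) (i : Fin N) : (wordsFrom A L i).card ≤ ∑ j, (A ^ L) i j := by
  classical
  induction L generalizing i with
  | zero =>
    have hone : ∑ j, (A ^ 0) i j = 1 := by simp [Matrix.one_apply]
    rw [hone]
    refine Finset.card_le_one.2 fun w hw v hv => funext fun k => ?_
    simp only [wordsFrom, Finset.mem_filter, Finset.mem_univ, true_and] at hw hv
    obtain ⟨α, hα, hw⟩ := hw
    obtain ⟨β, hβ, hv⟩ := hv
    obtain rfl : k = 0 := Fin.ext (by omega)
    rw [hw, hv]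
    exact hα.trans hβ.symm
  | succ L ih =>
    have hsub : wordsFrom A (L + 1) i ⊆ (Finset.univ.filter fun k => A i k = 1).biUnion
        fun k => (wordsFrom A L k).image fun w => (Fin.cons i w : Fin (L + 2) → Fin N) := by
      intro w hw
      simp only [wordsFrom, Finset.mem_filter, Finset.mem_univ, true_and] at hw
      obtain ⟨α, rfl, hw⟩ := hw
      simp only [Finset.mem_biUnion, Finset.mem_filter, Finset.mem_univ, true_and,
        Finset.mem_image, wordsFrom]
      refine ⟨α.seq 1, α.adm 0, fun k => α.seq (k + 1), ⟨shift A α, rfl, fun k => rfl⟩, ?_⟩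
      funext k
      rw [hw]
      refine Fin.cases ?_ (fun k => ?_) k <;> simp
    calc (wordsFrom A (L + 1) i).card
        ≤ ∑ k ∈ Finset.univ.filter (fun k => A i k = 1), (wordsFrom A L k).card :=
          (Finset.card_le_card hsub).trans (Finset.card_biUnion_le.trans
            (Finset.sum_le_sum fun k _ => Finset.card_image_le))
      _ ≤ ∑ k ∈ Finset.univ.filter (fun k => A i k = 1), A i k * ∑ j, (A ^ L) k j := by
          refine Finset.sum_le_sum fun k hk => ?_
          rw [(Finset.mem_filter.1 hk).2, one_mul]
          exact ih k
      _ ≤ ∑ k, A i k * ∑ j, (A ^ L) k j :=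
          Finset.sum_le_sum_of_subset (Finset.filter_subset _ _)
      _ = ∑ j, (A ^ (L + 1)) i j := by
          rw [pow_succ']
          simp only [Matrix.mul_apply, Finset.mul_sum]
          exact Finset.sum_comm

theorem encard_range_prefix_le (L : ℕ) :
    (range fun (α : SFT A) (k : Fin (L + 1)) => α.seq k).encard ≤ (entrySum (A ^ L) : ℕ∞) := by
  classical
  have hsub : (range fun (α : SFT A) (k : Fin (L + 1)) => α.seq k) ⊆
      (Finset.univ.biUnion (wordsFrom A L) : Finset (Fin (L + 1) → Fin N)) := by
    rintro _ ⟨α, rfl⟩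
    simp only [Finset.coe_biUnion, mem_iUnion, wordsFrom]
    exact ⟨α.seq 0, by simp, by simpa using ⟨α, rfl, fun k => rfl⟩⟩
  refine (encard_le_encard hsub).trans ?_
  rw [encard_coe_eq_coe_finsetCard]
  exact_mod_cast Finset.card_biUnion_le.trans (Finset.sum_le_sum fun i _ => card_wordsFrom_le L i)

theorem IsTransitionMatrix.tendsto_log_entrySum_div (hA : IsTransitionMatrix A) :
    Tendsto (fun n : ℕ => Real.log (entrySum (A ^ n)) / n) atTop (𝓝 (Real.log (rho A))) := by
  have hpos : ∀ n, (1 : ℝ) ≤ entrySum (A ^ n) := fun n => by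
    exact_mod_cast one_le_entrySum_pow hA n
  -- This keeps `rho A` away from `0`, where `Real.log` is discontinuous.
  have hrho : (1 : ℝ) ≤ rho A :=
    ge_of_tendsto' (tendsto_rho hA) fun n => Real.one_le_rpow (hpos n) (by positivity)
  refine ((Real.continuousAt_log (by linarith)).tendsto.comp (tendsto_rho hA)).congr fun n => ?_
  simp only [Function.comp_apply]
  rw [Real.log_rpow (by linarith [hpos n]), one_div, inv_mul_eq_div]

end Subshift

/-! ### Entropy of equi-continuous factors of the subshift -/

theorem topEntropy_le_of_equicontinuous_factor {Y : Type*} [MetricSpace Y] [CompactSpace Y]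
    {N : ℕ} {A : Matrix (Fin N) (Fin N) ℕ} (hA : IsTransitionMatrix A) (g : ℕ → Y → Y)
    (h : ℕ → SFT A → Y) (hequi : ∀ ε > 0, ∃ δ > 0, ∀ n α β, dist α β < δ → dist (h n α) (h n β) < ε)
    (hconj : ∀ n α, h (n + 1) (shift A α) = g n (h n α)) :
    topEntropy g (range (h 0)) ≤ ((Real.log (rho A) : ℝ) : EReal) := by
  have hiter : ∀ j α, iter g 0 j (h 0 α) = h j ((shift A)^[j] α) := by
    intro j α
    induction j with
    | zero => rfl
    | succ j ih =>
      rw [Function.iterate_succ_apply', hconj, ← ih]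
      simp [iter]
  refine iSup₂_le fun 𝒜 h𝒜 => ?_
  obtain ⟨ε, hε, hleb⟩ := lebesgue_number_lemma_of_metric_sUnion (isCompact_univ (X := Y)) h𝒜.1
    h𝒜.2.ge
  obtain ⟨δ, hδ, hδh⟩ := hequi ε hε
  obtain ⟨M, hM⟩ := exists_pow_lt_of_lt_one hδ (by norm_num : (1 / 2 : ℝ) < 1)
  have hcover : ∀ n, coverNumber (restrictCover (refinedCover g 𝒜 n) (range (h 0))) (range (h 0)) ≤
      (entrySum (A ^ (n + M)) : ℕ∞) := by
    intro n
    let pre : SFT A → Fin (n + M + 1) → Fin N := fun α k => α.seq k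
    choose U hU hUball using fun y : Y => hleb y (mem_univ y)
    -- a sequence with the given prefix, and the set of the refined cover around its image
    choose rep hrep using fun w : range pre => w.2
    -- `U y` contains the `ε`-ball about `y`, so `B w` contains every point whose orbit stays
    -- `ε`-close to that of `h 0 (rep w)` for times `j < n`.
    let B : range pre → Set Y := fun w =>
      ⋂ j : Fin n, iter g 0 j ⁻¹' U (h j ((shift A)^[j] (rep w)))
    have hB : ∀ α, h 0 α ∈ B ⟨pre α, mem_range_self α⟩ := by
      intro α
      refine mem_iInter.2 fun j => ?_
      rw [mem_preimage, hiter]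
      refine hUball _ (Metric.mem_ball.2 (hδh _ _ _ ?_))
      -- Agreement up to index `n + M` leaves, after `j < n` shifts, agreement at least up to index
      -- `M`, hence distance at most `2^{-M} < δ`.
      refine (SFT.dist_le_of_seq_eq fun k hk => ?_).trans_lt hM
      rw [shift_iterate_seq, shift_iterate_seq]
      have hj := j.2
      exact (congrFun (hrep ⟨pre α, mem_range_self α⟩) ⟨k + j, by omega⟩).symm
    refine le_trans (iInf₂_le_of_le (range fun w => B w ∩ range (h 0)) ?_
      (iInf_le_of_le ?_ le_rfl)) ?_
    · rintro _ ⟨w, rfl⟩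
      exact ⟨B w, ⟨_, fun j => hU _, rfl⟩, rfl⟩
    · rintro _ ⟨α, rfl⟩
      exact ⟨_, ⟨_, rfl⟩, hB α, mem_range_self α⟩
    · rw [← image_univ]
      refine (encard_image_le _ _).trans ?_
      rw [encard_univ, ENat.card_coe_set_eq]
      exact encard_range_prefix_le (n + M)
  have hpos : ∀ n, (1 : ℝ) ≤ entrySum (A ^ n) := fun n => by
    exact_mod_cast one_le_entrySum_pow hA n
  have hbound : ∀ n : ℕ,
      ENNReal.log (coverNumber (restrictCover (refinedCover g 𝒜 n) (range (h 0))) (range (h 0)) :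
        ENNReal) / (n : EReal) ≤
      ((Real.log (entrySum (A ^ n)) / n + Real.log (entrySum (A ^ M)) / n : ℝ) : EReal) := by
    intro n
    have hlog : ENNReal.log (coverNumber (restrictCover (refinedCover g 𝒜 n) (range (h 0)))
        (range (h 0)) : ENNReal) ≤
        ((Real.log (entrySum (A ^ n)) + Real.log (entrySum (A ^ M)) : ℝ) : EReal) := by
      have hle : (coverNumber (restrictCover (refinedCover g 𝒜 n) (range (h 0)))
          (range (h 0)) : ENNReal) ≤ ENNReal.ofReal (entrySum (A ^ (n + M))) := by
        rw [ENNReal.ofReal_natCast]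
        exact_mod_cast ENat.toENNReal_le.2 (hcover n)
      refine (ENNReal.log_monotone hle).trans ?_
      rw [ENNReal.log_ofReal_of_pos (by linarith [hpos (n + M)]), EReal.coe_le_coe_iff,
        ← Real.log_mul (by linarith [hpos n]) (by linarith [hpos M])]
      refine Real.log_le_log (by linarith [hpos (n + M)]) ?_
      rw [pow_add]
      exact_mod_cast entrySum_mul_le (A ^ n) (A ^ M)
    refine (EReal.div_le_div_right_of_nonneg (by positivity) hlog).trans (le_of_eq ?_)
    rw [← add_div, EReal.coe_div]
    rfl
  have hlim : Tendsto (fun n : ℕ => Real.log (entrySum (A ^ n)) / n +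
      Real.log (entrySum (A ^ M)) / n) atTop (𝓝 (Real.log (rho A))) := by
    simpa using hA.tendsto_log_entrySum_div.add (tendsto_const_div_atTop_nhds_zero_nat _)
  refine (limsup_le_limsup (Eventually.of_forall hbound)).trans (le_of_eq ?_)
  exact (continuous_coe_real_ereal.continuousAt.tendsto.comp hlim).limsup_eq

/-! ### The limit sets of infinite itineraries -/

section LimitSet

variable {X : Type*} {N : ℕ} {A : Matrix (Fin N) (Fin N) ℕ} {f : ℕ → X → X}
  {V : Fin N → ℕ → Set X}

theorem continuous_iter [TopologicalSpace X] (hf : ∀ n, Continuous (f n)) (i k : ℕ) :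
    Continuous (iter f i k) := by
  induction k with
  | zero => exact continuous_id
  | succ k ih => exact (hf _).comp ih

/-- `iter` adds maps at the late end. Comparing the itineraries of `x` and `f n x` requires
splitting off the earliest map instead. -/
theorem iter_succ_apply (n k : ℕ) (x : X) : iter f n (k + 1) x = iter f (n + 1) k (f n x) := by
  induction k with
  | zero => rfl
  | succ k ih =>
    have hidx : n + (k + 1) = n + 1 + k := by omega
    change f (n + (k + 1)) (iter f n (k + 1) x) = f (n + 1 + k) (iter f (n + 1) k (f n x))
    rw [ih, hidx]

theorem mem_itinSet {α : SFT A} {m n : ℕ} {x : X} :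
    x ∈ itinSet f V α m n ↔ ∀ k ≤ m, iter f n k x ∈ V (α.seq k) (n + k) := by
  simp [itinSet]

theorem itinSet_antitone (α : SFT A) (n : ℕ) : Antitone fun m => itinSet f V α m n :=
  fun _ _ hm _ hx => mem_itinSet.2 fun k hk => mem_itinSet.1 hx k (hk.trans hm)

theorem itinSet_congr {α β : SFT A} {m : ℕ} (h : β ∈ cylinder α m) (n : ℕ) :
    itinSet f V β m n = itinSet f V α m n :=
  iInter₂_congr fun k hk => by rw [h k hk]

theorem isClosed_itinSet [TopologicalSpace X] (hf : ∀ n, Continuous (f n))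
    (hV : ∀ i n, IsClosed (V i n)) (α : SFT A) (m n : ℕ) : IsClosed (itinSet f V α m n) :=
  isClosed_iInter fun _ => isClosed_iInter fun _ => (hV _ _).preimage (continuous_iter hf _ _)

/-- The set `⋂_m V_α^{m,n}` of points that follow the whole itinerary `α` from time `n` on. -/
def limitSet (f : ℕ → X → X) (V : Fin N → ℕ → Set X) (n : ℕ) (α : SFT A) : Set X :=
  ⋂ m, itinSet f V α m n

theorem mapsTo_limitSet (n : ℕ) (α : SFT A) :
    MapsTo (f n) (limitSet f V n α) (limitSet f V (n + 1) (shift A α)) := by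
  intro x hx
  refine mem_iInter.2 fun m => mem_itinSet.2 fun k hk => ?_
  have hmem := mem_itinSet.1 (mem_iInter.1 hx (m + 1)) (k + 1) (by omega)
  rw [iter_succ_apply] at hmem
  have hidx : n + 1 + k = n + (k + 1) := by omega
  rw [hidx]
  exact hmem

theorem nonempty_limitSet [TopologicalSpace X] [CompactSpace X] (hf : ∀ n, Continuous (f n))
    (hV : ∀ i n, IsClosed (V i n)) (h1 : H1 A f V) (n : ℕ) (α : SFT A) :
    (limitSet f V n α).Nonempty :=
  IsCompact.nonempty_iInter_of_sequence_nonempty_isCompact_isClosed _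
    (fun m => itinSet_antitone α n m.le_succ) (fun m => h1 m n α)
    (isClosed_itinSet hf hV α 0 n).isCompact (fun m => isClosed_itinSet hf hV α m n)

theorem subsingleton_limitSet [MetricSpace X] [CompactSpace X] (h2 : H2 A f V) (n : ℕ)
    (α : SFT A) : (limitSet f V n α).Subsingleton := by
  intro x hx y hy
  refine eq_of_forall_dist_le fun ε hε => ?_
  obtain ⟨M, hM⟩ := h2 α ε hε
  exact (Metric.dist_le_diam_of_mem (Metric.isBounded_of_compactSpace)
    (mem_iInter.1 hx M) (mem_iInter.1 hy M)).trans (hM M le_rfl n).le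

/-- `limitSet` as a point of the hyperspace. -/
def limitCompact [TopologicalSpace X] [CompactSpace X] (hf : ∀ n, Continuous (f n))
    (hV : ∀ i n, IsClosed (V i n)) (h1 : H1 A f V) (n : ℕ) (α : SFT A) : NonemptyCompacts X where
  carrier := limitSet f V n α
  isCompact' := (isClosed_iInter fun m => isClosed_itinSet hf hV α m n).isCompact
  nonempty' := nonempty_limitSet hf hV h1 n α

/-- Following the itinerary gives only the inclusion of the image. The reverse holds because the
target has at most one point and the image is nonempty. -/
theorem limitCompact_shift [MetricSpace X] [CompactSpace X] (hf : ∀ n, Continuous (f n))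
    (hV : ∀ i n, IsClosed (V i n)) (h1 : H1 A f V) (h2 : H2 A f V) (n : ℕ) (α : SFT A) :
    limitCompact hf hV h1 (n + 1) (shift A α) = induced f hf n (limitCompact hf hV h1 n α) := by
  refine SetLike.coe_injective (Subset.antisymm ?_ ?_)
  · obtain ⟨x, hx⟩ := nonempty_limitSet hf hV h1 n α
    intro y hy
    exact ⟨x, hx, subsingleton_limitSet h2 _ _ (mapsTo_limitSet n α hx) hy⟩
  · exact (mapsTo_limitSet n α).image_subset

theorem limitCompact_equicontinuous [MetricSpace X] [CompactSpace X] (hf : ∀ n, Continuous (f n))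
    (hV : ∀ i n, IsClosed (V i n)) (h1 : H1 A f V) (h2 : H2 A f V) :
    ∀ ε > 0, ∃ δ > 0, ∀ (n : ℕ) (α β : SFT A), dist α β < δ →
      dist (limitCompact hf hV h1 n α) (limitCompact hf hV h1 n β) < ε := by
  intro ε hε
  choose M hM using fun α : SFT A => h2 α ε hε
  -- A Lebesgue number for the cover by cylinders of depth `M γ` makes `δ` independent of `α`; it is
  -- independent of `n` because `M γ` is.
  obtain ⟨δ, hδ, hleb⟩ := lebesgue_number_lemma_of_metric (isCompact_univ (X := SFT A))
    (fun γ => isOpen_cylinder γ (M γ)) (fun γ _ => mem_iUnion.2 ⟨γ, mem_cylinder_self γ _⟩)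
  refine ⟨δ, hδ, fun n α β hαβ => ?_⟩
  obtain ⟨γ, hγ⟩ := hleb α (mem_univ α)
  have hsub : ∀ η ∈ Metric.ball α δ, limitSet f V n η ⊆ itinSet f V γ (M γ) n := fun η hη =>
    (iInter_subset _ (M γ)).trans (itinSet_congr (hγ hη) n).subset
  -- Both limit sets lie in the same `V_γ^{M γ, n}`, whose diameter is below `ε` and bounds their
  -- Hausdorff distance.
  refine lt_of_le_of_lt ?_ (hM γ (M γ) le_rfl n)
  refine le_trans (Metric.hausdorffDist_le_diam (nonempty_limitSet hf hV h1 n α)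
    Metric.isBounded_of_compactSpace (nonempty_limitSet hf hV h1 n β)
    Metric.isBounded_of_compactSpace) ?_
  refine Metric.diam_mono (union_subset ?_ ?_) Metric.isBounded_of_compactSpace
  · exact hsub α (Metric.mem_ball_self hδ)
  · exact hsub β (by rwa [Metric.mem_ball, dist_comm])

end LimitSet

end NDS

theorem theorem4p6 {X : Type*} [MetricSpace X] [CompactSpace X]
    (f : ℕ → X → X) (hf : ∀ n, Continuous (f n))
    {N : ℕ} (A : Matrix (Fin N) (Fin N) ℕ) (hA : NDS.IsTransitionMatrix A)
    (V : Fin N → ℕ → Set X)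
    (hVne : ∀ i n, (V i n).Nonempty) (hVcl : ∀ i n, IsClosed (V i n))
    (h1 : NDS.H1 A f V) (h2 : NDS.H2 A f V) :
    ∃ C : ℕ → Set (NonemptyCompacts X),
      (∀ n, (C n).Nonempty ∧ IsCompact (C n) ∧ C n ⊆ ⋃ i, NDS.hyper (V i n) ∧
        NDS.induced f hf n '' C n = C (n + 1)) ∧
      NDS.EquiSemiconjugate (fun _ => NDS.shift A) (fun _ => (Set.univ : Set (NDS.SFT A)))
        (NDS.induced f hf) C ∧
      NDS.topEntropy (NDS.induced f hf) (C 0) ≤ ((Real.log (NDS.rho A) : ℝ) : EReal) := by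
  let h := NDS.limitCompact hf hVcl h1
  have hshift : ∀ n α, h (n + 1) (NDS.shift A α) = NDS.induced f hf n (h n α) :=
    NDS.limitCompact_shift hf hVcl h1 h2
  have hequi := NDS.limitCompact_equicontinuous hf hVcl h1 h2
  have hcont : ∀ n, Continuous (h n) := fun n => Metric.continuous_iff.2 fun β ε hε => by
    obtain ⟨δ, hδ, hδh⟩ := hequi ε hε
    exact ⟨δ, hδ, fun α => hδh n α β⟩
  have himage : ∀ n, NDS.induced f hf n '' Set.range (h n) = Set.range (h (n + 1)) := by
    intro n
    -- Precomposing `h (n + 1)` with the surjective shift does not change its range.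
    rw [← Set.range_comp, ← hA.shift_surjective.range_comp (h (n + 1))]
    exact congrArg Set.range (funext fun α => (hshift n α).symm)
  have := hA.nonempty_SFT
  refine ⟨fun n => Set.range (h n), fun n => ⟨Set.range_nonempty _, isCompact_range (hcont n), ?_,
    himage n⟩, ⟨fun _ _ _ => trivial, fun n => ?_, fun n α => ⟨h n α, α.1, rfl⟩, ?_, ?_, ?_⟩,
    NDS.topEntropy_le_of_equicontinuous_factor hA _ h hequi hshift⟩
  · rintro _ ⟨α, rfl⟩
    -- The time-zero condition of the itinerary puts the limit set inside `V_{a_0,n}`.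
    refine Set.mem_iUnion.2 ⟨α.seq 0, fun x hx => ?_⟩
    exact NDS.mem_itinSet.1 (Set.mem_iInter.1 hx 0) 0 le_rfl
  · exact Set.mapsTo_iff_image_subset.2 (himage n).subset
  · intro ε hε
    obtain ⟨δ, hδ, hδh⟩ := hequi ε hε
    exact ⟨δ, hδ, fun n α β => hδh n α β⟩
  · rintro n ⟨_, α, rfl⟩
    exact ⟨⟨α, trivial⟩, rfl⟩
  · exact fun n α => hshift n α
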